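/- Consider a finite system of sporadic real-time tasks $\tau_1,\dots,\tau_n$ with implicit deadlines: task $\tau_i$ has worst-case execution time $C_i>0$ and period $T_i>0$; it releases a finite or infinite sequence of jobs at times $\ge 0$, with consecutive releases at least $T_i$ apart; each of its jobs needs at most $C_i$ units of execution and has its absolute deadline $T_i$ time units after its release. Jobs of the same task are executed in sequence. The utilization of $\tau_i$ is $U_i=C_i/T_i$. Under preemptive global rate-monotonic (RM) scheduling on $M\ge 1$ identical unit-speed processors, tasks with shorter periods have higher priority (ties between tasks being broken by an arbitrary fixed order), and at any time the $M$ highest-priority jobs of the ready queue (all of them, if there are fewer than $M$) are executed; no job executes on more than one processor at a time. Then $b=\frac{3+\sqrt7}{2}\approx 2.823$ is a capacity augmentation factor of global RM for implicit-deadline sporadic task systems: for all $M\ge 1$ and every such system, if $$\frac1M\sum_{i=1}^n U_i\le\frac1b\qquad\text{and}\qquad \max_{1\le i\le n}U_i\le\frac1b,$$ then every task is schedulable by global RM on $M$ processors, that is, for all admissible job releases each of its jobs finishes no later than its absolute deadline. -/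

import Mathlib

namespace RealTime

/-- A sporadic task: worst-case execution time `C`, period (minimum inter-arrival time) `T`
and relative deadline `D`. -/
structure SporadicTask where
  C : ℝ
  T : ℝ
  D : ℝ
  C_pos : 0 < C
  T_pos : 0 < T
  D_pos : 0 < D

/-- The utilization `C / T`. -/
noncomputable def SporadicTask.utilization (τ : SporadicTask) : ℝ := τ.C / τ.T

/-- Every relative deadline is equal to the period. -/
def ImplicitDeadline {n : ℕ} (τ : Fin n → SporadicTask) : Prop :=
  ∀ i, (τ i).D = (τ i).T

/-- A family of jobs that the task system `τ` may release (from time `0` on).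
Task `i` releases the jobs `(i, j)` with `j < count i`, finitely or infinitely many;
job `(i, j)` is released at `release i j` and needs `exec i j ≤ C` units of execution. -/
structure JobFamily {n : ℕ} (τ : Fin n → SporadicTask) where
  count : Fin n → ℕ∞
  release : Fin n → ℕ → ℝ
  exec : Fin n → ℕ → ℝ
  release_nonneg : ∀ i (j : ℕ), (j : ℕ∞) < count i → 0 ≤ release i j
  separation : ∀ i (j : ℕ), ((j + 1 : ℕ) : ℕ∞) < count i →
    release i j + (τ i).T ≤ release i (j + 1)
  exec_nonneg : ∀ i (j : ℕ), (j : ℕ∞) < count i → 0 ≤ exec i j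
  exec_le : ∀ i (j : ℕ), (j : ℕ∞) < count i → exec i j ≤ (τ i).C

section
variable {n : ℕ} {τ : Fin n → SporadicTask}

/-- Amount of execution that job `(i, j)` has received before time `t`, where `S i j` is the
set of time instants at which the job is being executed (on one of the processors). -/
noncomputable def service (J : JobFamily τ) (S : Fin n → ℕ → Set ℝ)
    (i : Fin n) (j : ℕ) (t : ℝ) : ℝ :=
  MeasureTheory.volume.real (S i j ∩ Set.Ico (J.release i j) t)

/-- Job `(i, j)` has finished by time `t`. -/
def FinishedBy (J : JobFamily τ) (S : Fin n → ℕ → Set ℝ)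
    (i : Fin n) (j : ℕ) (t : ℝ) : Prop :=
  J.exec i j ≤ service J S i j t

/-- Job `(i, j)` is in the ready queue at time `t`: it exists, it has been released, it is not
finished, and all earlier jobs of the same task are finished. -/
def Ready (J : JobFamily τ) (S : Fin n → ℕ → Set ℝ)
    (i : Fin n) (j : ℕ) (t : ℝ) : Prop :=
  (j : ℕ∞) < J.count i ∧ J.release i j ≤ t ∧ ¬ FinishedBy J S i j t ∧
    ∀ j' < j, FinishedBy J S i j' t

/-- `S` is the preemptive global fixed-priority schedule of the jobs `J` on `M` identical
unit-speed processors: at every instant exactly the `M` highest-priority jobs of the ready queue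
(all of them, if there are fewer than `M`) are executed. A smaller value of `prio` means a
higher priority. -/
structure IsGlobalFixedPrioritySchedule (M : ℕ) (prio : Fin n → ℕ) (J : JobFamily τ)
    (S : Fin n → ℕ → Set ℝ) : Prop where
  measurableSet : ∀ i j, MeasurableSet (S i j)
  mem_iff : ∀ i j t, t ∈ S i j ↔ Ready J S i j t ∧
    {p : Fin n × ℕ | prio p.1 < prio i ∧ Ready J S p.1 p.2 t}.encard < (M : ℕ∞)

end

/-- Task `i` is schedulable by global fixed-priority scheduling on `M` processors: whatever jobs
are released, each job of task `i` finishes by its absolute deadline. -/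
def TaskSchedulable {n : ℕ} (τ : Fin n → SporadicTask) (M : ℕ) (prio : Fin n → ℕ)
    (i : Fin n) : Prop :=
  ∀ (J : JobFamily τ) (S : Fin n → ℕ → Set ℝ), IsGlobalFixedPrioritySchedule M prio J S →
    ∀ j : ℕ, (j : ℕ∞) < J.count i → FinishedBy J S i j (J.release i j + (τ i).D)

/-- All tasks are schedulable. -/
def Schedulable {n : ℕ} (τ : Fin n → SporadicTask) (M : ℕ) (prio : Fin n → ℕ) : Prop :=
  ∀ i, TaskSchedulable τ M prio i

/-- `prio` is a rate-monotonic priority assignment: tasks have distinct priorities, and a task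
with a shorter period has a higher priority (ties are broken arbitrarily). -/
def IsRateMonotonic {n : ℕ} (τ : Fin n → SporadicTask) (prio : Fin n → ℕ) : Prop :=
  Function.Injective prio ∧ ∀ i j, (τ i).T < (τ j).T → prio i < prio j

/-- `b` is a capacity augmentation factor of global RM for implicit-deadline sporadic systems:
on any number `M ≥ 1` of processors, each such system whose total utilization divided by `M` and
whose maximum utilization are at most `1 / b` is schedulable by global RM. -/
def IsGlobalRMCapacityAugmentationFactor (b : ℝ) : Prop :=
  0 < b ∧ ∀ (M : ℕ), 1 ≤ M → ∀ (n : ℕ) (τ : Fin n → SporadicTask), ImplicitDeadline τ →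
    (∑ i, (τ i).utilization) / (M : ℝ) ≤ 1 / b →
    (∀ i, (τ i).utilization ≤ 1 / b) →
    ∀ prio : Fin n → ℕ, IsRateMonotonic τ prio → Schedulable τ M prio

end RealTime

/-! Put u = 1/b = 3 - √7, a root of u² - 6u + 2. Suppose a job of task k misses its deadline d while
all higher-priority tasks meet theirs. It received less than C_k ≤ u T_k, so for less than a
fraction u of its span some processor was free of more important work. Among the release times from
which the window up to d keeps this property, let a be the earliest (`exists_window`), and A = d -
a. By minimality, each more important job pending at a was served at rate at least u ≥ U_i before a.

This bounds the carry-in: with a last offset o_i ≤ A, task i executes at most U_i o_i up to a + o_i,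
and at most U_i (o_i + T_i) ≤ U_i (o_i + A) up to d (`exists_workload_le`), since T_i ≤ T_k ≤ A by
rate-monotonicity. Elapsed time is at most non-busy time plus work divided by M. At the instants a +
o_j this limits ∑ U_i o_i / M, and `window_length_le` then bounds the supply on the whole window by
A; at d the same comparison makes it exceed A. -/

open MeasureTheory Set

namespace RealTime

/-! ### The inequality that fixes the constant -/

/-- The quadratic inequality behind the capacity augmentation factor: `v` are the scaled
utilizations, `t` the last release offsets in a window of length `A`. -/
lemma window_length_le {ι : Type*} (s : Finset ι) (v t : ι → ℝ) {u A : ℝ}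
    (hv : ∀ i ∈ s, 0 ≤ v i) (hA : 0 < A) (hu : u ^ 2 - 6 * u + 2 = 0) (hu1 : u < 1)
    (hx : ∑ i ∈ s, v i ≤ u)
    (h : ∀ j ∈ s, t j ≤ u * A + ∑ i ∈ s, v i * t i + A * ∑ i ∈ s, if t i < t j then v i else 0) :
    u * A + ∑ i ∈ s, v i * t i + A * ∑ i ∈ s, v i ≤ A := by
  set x := ∑ i ∈ s, v i with hxdef
  set w := ∑ i ∈ s, v i * t i with hw
  have hx0 : 0 ≤ x := Finset.sum_nonneg hv
  set Q := ∑ j ∈ s, v j * ∑ i ∈ s, if t i < t j then v i else 0 with hQ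
  -- For each ordered pair, at most one of `t i < t j` and `t j < t i` holds.
  have hQ2 : Q + Q ≤ x * x := by
    have e1 : Q = ∑ j ∈ s, ∑ i ∈ s, if t i < t j then v j * v i else 0 := by
      simp only [hQ, Finset.mul_sum, mul_ite, mul_zero]
    have e2 : Q = ∑ j ∈ s, ∑ i ∈ s, if t j < t i then v j * v i else 0 := by
      rw [e1, Finset.sum_comm]
      simp only [mul_comm]
    have e3 : x * x = ∑ j ∈ s, ∑ i ∈ s, v j * v i := by rw [hxdef, Finset.sum_mul_sum]
    rw [e3]
    nth_rewrite 1 [e1]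
    rw [e2, ← Finset.sum_add_distrib]
    refine Finset.sum_le_sum fun j hj => ?_
    rw [← Finset.sum_add_distrib]
    refine Finset.sum_le_sum fun i hi => ?_
    have := mul_nonneg (hv j hj) (hv i hi)
    split_ifs <;> linarith
  have hs : w ≤ x * (u * A + w) + A * Q := by
    have : w ≤ ∑ j ∈ s, v j * (u * A + w + A * ∑ i ∈ s, if t i < t j then v i else 0) :=
      Finset.sum_le_sum fun j hj => mul_le_mul_of_nonneg_left (h j hj) (hv j hj)
    refine this.trans (le_of_eq ?_)
    rw [hxdef, hQ, Finset.sum_mul, Finset.mul_sum, ← Finset.sum_add_distrib]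
    exact Finset.sum_congr rfl fun j _ => by ring
  have hAQ : A * Q ≤ A * (x * x / 2) := mul_le_mul_of_nonneg_left (by linarith) hA.le
  -- 1 - 2x + x²/2 decreases for x ≤ 2 and, by the equation for u, equals u at x = u.
  have key : u ≤ 1 - 2 * x + x ^ 2 / 2 := by
    nlinarith [mul_nonneg (sub_nonneg.2 hx) (by linarith : 0 ≤ 2 - (u + x) / 2)]
  have h1x : 0 < 1 - x := by linarith
  refine le_of_mul_le_mul_left ?_ h1x
  -- By `hs` and `hAQ`, (1 - x) w ≤ A (u x + x²/2); the goal then reduces to `key` times A.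
  nlinarith [mul_le_mul_of_nonneg_left key hA.le]

/-! ### Service received by a job -/

variable {n : ℕ} {τ : Fin n → SporadicTask} {J : JobFamily τ} {S : Fin n → ℕ → Set ℝ}
  {M : ℕ} {prio : Fin n → ℕ}

lemma volume_inter_Ico_ne_top (A : Set ℝ) (a b : ℝ) : volume (A ∩ Ico a b) ≠ ⊤ :=
  ((measure_mono inter_subset_right).trans_lt measure_Ico_lt_top).ne

lemma volumeReal_inter_Ico_mono {A B : Set ℝ} {a b c d : ℝ}
    (h : A ∩ Ico a b ⊆ B ∩ Ico c d) :
    volume.real (A ∩ Ico a b) ≤ volume.real (B ∩ Ico c d) :=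
  measureReal_mono h (volume_inter_Ico_ne_top _ _ _)

lemma volumeReal_inter_Ico_add (A : Set ℝ) {a b c : ℝ} (hab : a ≤ b) (hbc : b ≤ c) :
    volume.real (A ∩ Ico a c) = volume.real (A ∩ Ico a b) + volume.real (A ∩ Ico b c) := by
  rw [← measureReal_inter_add_sdiff (s := A ∩ Ico a c) (t := Iio b) measurableSet_Iio
    (volume_inter_Ico_ne_top _ _ _)]
  congr 2 <;> ext y <;> simp only [mem_inter_iff, mem_Ico, mem_Iio, mem_sdiff, not_lt]
  · exact ⟨fun h => ⟨h.1.1, h.1.2.1, h.2⟩, fun h => ⟨⟨h.1, h.2.1, h.2.2.trans_le hbc⟩, h.2.2⟩⟩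
  · exact ⟨fun h => ⟨h.1.1, h.2, h.1.2.2⟩, fun h => ⟨⟨h.1, hab.trans h.2.1, h.2.2⟩, h.2.1⟩⟩

lemma volumeReal_inter_Ico_le (A : Set ℝ) {a b : ℝ} (hab : a ≤ b) :
    volume.real (A ∩ Ico a b) ≤ b - a := by
  have h := measureReal_mono (μ := volume) (inter_subset_right (s := A) (t := Ico a b))
    measure_Ico_lt_top.ne
  rwa [Real.volume_real_Ico_of_le hab] at h

lemma service_mono (i : Fin n) (j : ℕ) : Monotone (service J S i j) := fun _ _ h =>
  volumeReal_inter_Ico_mono (inter_subset_inter_right _ (Ico_subset_Ico_right h))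

lemma continuous_service (i : Fin n) (j : ℕ) : Continuous (service J S i j) := by
  refine (LipschitzWith.of_le_add fun x y => ?_).continuous
  rcases le_total x y with h | h
  · linarith [service_mono (J := J) (S := S) i j h, dist_nonneg (x := x) (y := y)]
  · rw [Real.dist_eq, abs_of_nonneg (sub_nonneg.2 h)]
    rcases le_total (J.release i j) y with hr | hr
    · have := volumeReal_inter_Ico_add (S i j) hr h
      have := volumeReal_inter_Ico_le (S i j) h
      simp only [service]
      linarith
    · have : service J S i j x ≤ volume.real (S i j ∩ Ico y x) :=
        volumeReal_inter_Ico_mono (inter_subset_inter_right _ (Ico_subset_Ico_left hr))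
      have := volumeReal_inter_Ico_le (S i j) h
      have : 0 ≤ service J S i j y := measureReal_nonneg
      linarith

lemma FinishedBy.mono {i : Fin n} {j : ℕ} {s t : ℝ} (h : FinishedBy J S i j s) (hst : s ≤ t) :
    FinishedBy J S i j t :=
  h.trans (service_mono i j hst)

namespace IsGlobalFixedPrioritySchedule

lemma ready (hS : IsGlobalFixedPrioritySchedule M prio J S) {i : Fin n} {j : ℕ} {t : ℝ}
    (h : t ∈ S i j) : Ready J S i j t :=
  ((hS.mem_iff i j t).1 h).1

/-- Service grows continuously from 0, so an excess would first pass through `exec`; from then on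
the job is finished and never executes. -/
lemma service_le_exec (hS : IsGlobalFixedPrioritySchedule M prio J S) {i : Fin n} {j : ℕ}
    (hj : (j : ℕ∞) < J.count i) (t : ℝ) : service J S i j t ≤ J.exec i j := by
  by_contra! hlt
  have h0 : service J S i j (J.release i j) = 0 := by simp [service]
  have hrt : J.release i j ≤ t := by
    by_contra! h
    have := service_mono (J := J) (S := S) i j h.le
    linarith [J.exec_nonneg i j hj]
  obtain ⟨s, hs, hse⟩ := intermediate_value_Icc hrt
    (continuous_service (J := J) (S := S) i j).continuousOn
    ⟨h0.trans_le (J.exec_nonneg i j hj), hlt.le⟩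
  have h2 : S i j ∩ Ico s t = ∅ := by
    refine eq_empty_of_forall_notMem fun y hy => (hS.ready hy.1).2.2.1 ?_
    exact FinishedBy.mono hse.ge hy.2.1
  have := volumeReal_inter_Ico_add (S i j) hs.1 hs.2
  rw [h2, measureReal_empty, add_zero] at this
  exact hlt.ne' (this.trans hse)

lemma volumeReal_inter_Ico_le_exec_sub_service
    (hS : IsGlobalFixedPrioritySchedule M prio J S) {i : Fin n} {j : ℕ}
    (hj : (j : ℕ∞) < J.count i) {a t : ℝ} (ha : J.release i j ≤ a) :
    volume.real (S i j ∩ Ico a t) ≤ J.exec i j - service J S i j a := by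
  rcases le_total a t with h | h
  · have := volumeReal_inter_Ico_add (S i j) ha h
    have := hS.service_le_exec hj t
    simp only [service] at this ⊢
    linarith
  · rw [Ico_eq_empty_of_le h, inter_empty, measureReal_empty]
    linarith [hS.service_le_exec hj a]

lemma volumeReal_inter_Ico_le_C (hS : IsGlobalFixedPrioritySchedule M prio J S) (i : Fin n)
    (j : ℕ) (a t : ℝ) : volume.real (S i j ∩ Ico a t) ≤ (τ i).C := by
  by_cases hj : (j : ℕ∞) < J.count i
  · refine le_trans ?_ ((hS.service_le_exec hj t).trans (J.exec_le i j hj))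
    exact volumeReal_inter_Ico_mono fun y hy => ⟨hy.1, (hS.ready hy.1).2.1, hy.2.2⟩
  · have : S i j = ∅ := eq_empty_of_forall_notMem fun y hy => hj (hS.ready hy).1
    simpa [this] using (τ i).C_pos.le

end IsGlobalFixedPrioritySchedule

/-! ### Release times and the workload of one task -/

lemma JobFamily.release_add_le (J : JobFamily τ) (i : Fin n) {j k : ℕ} (hjk : j ≤ k)
    (hk : (k : ℕ∞) < J.count i) :
    J.release i j + ((k : ℝ) - j) * (τ i).T ≤ J.release i k := by
  induction k, hjk using Nat.le_induction with
  | base => simp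
  | succ k _ ih =>
    have h1 := ih (lt_trans (by exact_mod_cast k.lt_succ_self) hk)
    have h2 := J.separation i k hk
    push_cast
    linarith

lemma JobFamily.mul_le_release (J : JobFamily τ) (i : Fin n) {j : ℕ}
    (hj : (j : ℕ∞) < J.count i) : (j : ℝ) * (τ i).T ≤ J.release i j := by
  have h := J.release_add_le i (Nat.zero_le j) hj
  have := J.release_nonneg i 0 (lt_of_le_of_lt (by simp) hj)
  simp only [Nat.cast_zero, sub_zero] at h
  linarith

lemma JobFamily.exists_le_release_or_count_le (J : JobFamily τ) (i : Fin n) (a : ℝ) :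
    ∃ j : ℕ, J.count i ≤ j ∨ a ≤ J.release i j := by
  obtain ⟨j, hj⟩ := exists_nat_ge (a / (τ i).T)
  refine ⟨j, or_iff_not_imp_left.2 fun h => ?_⟩
  exact ((div_le_iff₀ (τ i).T_pos).1 hj).trans (J.mul_le_release i (not_le.1 h))

lemma JobFamily.finite_release_le (J : JobFamily τ) (i : Fin n) (a : ℝ) :
    {j : ℕ | (j : ℕ∞) < J.count i ∧ J.release i j ≤ a}.Finite := by
  obtain ⟨N, hN⟩ := exists_nat_ge (a / (τ i).T)
  refine (finite_Iic N).subset fun j hj => ?_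
  have h1 := (J.mul_le_release i hj.1).trans hj.2
  have h2 := (div_le_iff₀ (τ i).T_pos).1 hN
  exact_mod_cast le_of_mul_le_mul_right (h1.trans h2) (τ i).T_pos

lemma utilization_pos (τ : SporadicTask) : 0 < τ.utilization := div_pos τ.C_pos τ.T_pos

lemma utilization_mul_T (τ : SporadicTask) : τ.utilization * τ.T = τ.C :=
  div_mul_cancel₀ _ τ.T_pos.ne'

/-- The instants at which some job of task `i` is executed. -/
def executing (S : Fin n → ℕ → Set ℝ) (i : Fin n) : Set ℝ := ⋃ j, S i j

/-- Workload of a task meeting its deadlines in a window starting at `a`, when each unfinished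
job released before `a` has been served at a rate of at least the utilization of the task. -/
lemma IsGlobalFixedPrioritySchedule.exists_workload_le
    (hS : IsGlobalFixedPrioritySchedule M prio J S) (i : Fin n)
    (hmeet : ∀ j : ℕ, (j : ℕ∞) < J.count i → FinishedBy J S i j (J.release i j + (τ i).T))
    (a : ℝ)
    (hcarry : ∀ j : ℕ, (j : ℕ∞) < J.count i → J.release i j < a → ¬ FinishedBy J S i j a →
      (τ i).utilization * (a - J.release i j) ≤ service J S i j a) :
    ∃ w, 0 ≤ w ∧ w ≤ (τ i).T ∧ ∀ (m : ℕ) (t : ℝ), t ≤ a + w + m * (τ i).T →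
      volume.real (executing S i ∩ Ico a t) ≤ (τ i).utilization * (w + m * (τ i).T) := by
  classical
  have hex := J.exists_le_release_or_count_le i a
  -- The first job not released before `a`, or an index past the last job.
  set q := Nat.find hex with hq
  have hT := (τ i).T_pos
  have hU := utilization_pos (τ i)
  obtain ⟨w, hw0, hwT, hcw, hnext⟩ : ∃ w, 0 ≤ w ∧ w ≤ (τ i).T ∧
      (∀ t, volume.real ((⋃ j ∈ Iio q, S i j) ∩ Ico a t) ≤ (τ i).utilization * w) ∧
      ((q : ℕ∞) < J.count i → a + w ≤ J.release i q) := by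
    rcases hq0 : q with _ | p
    · refine ⟨0, le_rfl, hT.le, fun t => by simp, fun h => ?_⟩
      have := (Nat.find_spec hex).resolve_left (by rw [← hq, hq0]; exact not_le.2 h)
      rw [← hq, hq0] at this
      simpa using this
    · have hp : ¬ _ := Nat.find_min hex (m := p) (by omega)
      push Not at hp
      obtain ⟨hpc, hpa⟩ := hp
      -- Jobs before `p` have deadlines no later than the release of `p`, so only `p` can carry work
      -- into the window.
      have hsub : ∀ t, volume.real ((⋃ j ∈ Iio (p + 1), S i j) ∩ Ico a t) ≤
          volume.real (S i p ∩ Ico a t) := by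
        refine fun t => volumeReal_inter_Ico_mono fun y hy => ⟨?_, hy.2⟩
        obtain ⟨j, hj, hyj⟩ := mem_iUnion₂.1 hy.1
        rcases (Nat.lt_succ_iff.1 hj).lt_or_eq with hlt | rfl
        · have hjc := (hS.ready hyj).1
          refine absurd ((hmeet j hjc).mono ?_) (hS.ready hyj).2.2.1
          have h1 := J.release_add_le i hlt.le hpc
          have h2 : (1 : ℝ) ≤ (p : ℝ) - j := by
            have : ((j + 1 : ℕ) : ℝ) ≤ p := by exact_mod_cast hlt
            push_cast at this; linarith
          have h3 := hy.2.1
          nlinarith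
        · exact hyj
      have hempty : ∀ t, FinishedBy J S i p a → S i p ∩ Ico a t = ∅ := fun t hf =>
        eq_empty_of_forall_notMem fun y hy => (hS.ready hy.1).2.2.1 (hf.mono hy.2.1)
      -- `w` is the time left at `a` until the deadline of job `p`: having been served at rate U, it
      -- has at most C - U (a - release) = U w left.
      refine ⟨max 0 (J.release i p + (τ i).T - a), le_max_left _ _,
        max_le hT.le (by linarith), fun t => (hsub t).trans ?_, fun h => ?_⟩
      · by_cases hf : FinishedBy J S i p a
        · rw [hempty t hf, measureReal_empty]
          exact mul_nonneg hU.le (le_max_left _ _)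
        · have h1 := hS.volumeReal_inter_Ico_le_exec_sub_service hpc (t := t) hpa.le
          have h2 := hcarry p hpc hpa hf
          have h3 := J.exec_le i p hpc
          have h4 := utilization_mul_T (τ i)
          have h5 := mul_le_mul_of_nonneg_left (le_max_right 0 (J.release i p + (τ i).T - a)) hU.le
          nlinarith
      · have h1 := J.separation i p (by exact_mod_cast h)
        have h2 := (Nat.find_spec hex).resolve_left (by rw [← hq, hq0]; exact not_le.2 h)
        rw [← hq, hq0] at h2
        rcases max_cases 0 (J.release i p + (τ i).T - a) with h | h <;> linarith [h.1]
  refine ⟨w, hw0, hwT, fun m t ht => ?_⟩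
  have hsub : executing S i ∩ Ico a t ⊆ ((⋃ j ∈ Iio q, S i j) ∩ Ico a t) ∪
      ⋃ j ∈ Finset.Ico q (q + m), (S i j ∩ Ico a t) := by
    rintro y ⟨hy, hyt⟩
    obtain ⟨j, hj⟩ := mem_iUnion.1 hy
    by_cases hjq : j < q
    · exact Or.inl ⟨mem_iUnion₂.2 ⟨j, hjq, hj⟩, hyt⟩
    refine Or.inr (mem_iUnion₂.2 ⟨j, Finset.mem_Ico.2 ⟨not_lt.1 hjq, ?_⟩, hj, hyt⟩)
    by_contra! hjm
    have hjc := (hS.ready hj).1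
    have h1 := J.release_add_le i (not_lt.1 hjq) hjc
    have h2 := hnext (lt_of_le_of_lt (by exact_mod_cast not_lt.1 hjq) hjc)
    have h3 : (m : ℝ) ≤ (j : ℝ) - q := by
      have : ((q + m : ℕ) : ℝ) ≤ j := by exact_mod_cast hjm
      push_cast at this; linarith
    have h4 := (hS.ready hj).2.1
    nlinarith [hyt.2, mul_le_mul_of_nonneg_right h3 hT.le]
  have hfin : volume (⋃ j ∈ Finset.Ico q (q + m), (S i j ∩ Ico a t)) ≠ ⊤ :=
    ((measure_mono (iUnion₂_subset fun _ _ => inter_subset_right)).trans_lt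
      measure_Ico_lt_top).ne
  calc volume.real (executing S i ∩ Ico a t)
      ≤ _ := measureReal_mono hsub
          (measure_union_ne_top (volume_inter_Ico_ne_top _ _ _) hfin)
    _ ≤ _ := measureReal_union_le _ _
    _ ≤ (τ i).utilization * w + ∑ j ∈ Finset.Ico q (q + m), (τ i).C := by
        gcongr
        · exact hcw t
        · exact (measureReal_biUnion_finset_le _ _).trans
            (Finset.sum_le_sum fun j _ => hS.volumeReal_inter_Ico_le_C i j a t)
    _ = _ := by
        rw [Finset.sum_const, Nat.card_Ico, nsmul_eq_mul, ← utilization_mul_T (τ i)]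
        simp only [add_tsub_cancel_left]
        ring

/-! ### Busy instants -/

open Classical in
/-- The instants at which all `M` processors execute tasks of higher priority than task `k`. -/
def busy (S : Fin n → ℕ → Set ℝ) (M : ℕ) (prio : Fin n → ℕ) (k : Fin n) : Set ℝ :=
  {t | M ≤ (Finset.univ.filter fun i => prio i < prio k ∧ t ∈ executing S i).card}

/-- Because of this, counting ready jobs amounts to counting tasks. -/
lemma Ready.eq {i : Fin n} {j j' : ℕ} {t : ℝ} (h : Ready J S i j t) (h' : Ready J S i j' t) :
    j = j' := by
  rcases lt_trichotomy j j' with hlt | rfl | hlt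
  · exact absurd (h'.2.2.2 j hlt) h.2.2.1
  · rfl
  · exact absurd (h.2.2.2 j' hlt) h'.2.2.1

/-- Processors not executing a ready job of task `i` are all executing more important tasks. -/
lemma IsGlobalFixedPrioritySchedule.mem_busy
    (hS : IsGlobalFixedPrioritySchedule M prio J S) {i k : Fin n}
    (hik : prio i ≤ prio k) {j : ℕ} {t : ℝ} (hr : Ready J S i j t) (ht : t ∉ S i j) :
    t ∈ busy S M prio k := by
  classical
  have hproj : ∀ p : Fin n, {q : Fin n × ℕ | prio q.1 < prio p ∧ Ready J S q.1 q.2 t}.encard =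
      ((Finset.univ.filter fun q => prio q < prio p ∧ ∃ l, Ready J S q l t).card : ℕ∞) := by
    intro p
    have hinj : InjOn Prod.fst
        {q : Fin n × ℕ | prio q.1 < prio p ∧ Ready J S q.1 q.2 t} := by
      rintro ⟨a, b⟩ h ⟨a', b'⟩ h' (rfl : a = a')
      exact congrArg (Prod.mk a) (Ready.eq h.2 h'.2)
    rw [← hinj.encard_image, ← Set.encard_coe_eq_coe_finsetCard]
    congr 1
    ext q
    simp only [mem_image, mem_ofPred_eq, Prod.exists, exists_and_right, exists_eq_right,
      Finset.coe_filter, Finset.mem_univ, true_and, exists_and_left]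
  set E := Finset.univ.filter fun q => prio q < prio k ∧ t ∈ executing S q with hE
  change M ≤ E.card
  by_contra! hlt
  set R := Finset.univ.filter fun q => prio q < prio i ∧ ∃ l, Ready J S q l t with hR
  have hRM : M ≤ R.card := by
    by_contra! h
    refine ht ((hS.mem_iff i j t).2 ⟨hr, ?_⟩)
    rw [hproj]
    exact_mod_cast h
  have hne : (R \ E).Nonempty := by
    rw [Finset.nonempty_iff_ne_empty, Ne, Finset.sdiff_eq_empty_iff_subset]
    intro h
    have := Finset.card_le_card h
    omega
  -- The most important ready task that is not executing: all ready tasks above it execute, and they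
  -- are fewer than `M`, so it would have to execute too.
  obtain ⟨p, hp, hmin⟩ := Finset.exists_min_image (R \ E) prio hne
  obtain ⟨hpR, hpE⟩ := Finset.mem_sdiff.1 hp
  obtain ⟨hpi, l, hl⟩ := (Finset.mem_filter.1 hpR).2
  refine hpE (Finset.mem_filter.2 ⟨Finset.mem_univ _, hpi.trans_le hik,
    mem_iUnion.2 ⟨l, (hS.mem_iff p l t).2 ⟨hl, ?_⟩⟩⟩)
  rw [hproj]
  refine Nat.cast_lt.2 (lt_of_le_of_lt (Finset.card_le_card fun q hq => ?_) hlt)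
  obtain ⟨-, hqp, hqr⟩ := Finset.mem_filter.1 hq
  by_contra hqE
  exact (hmin q (Finset.mem_sdiff.2
    ⟨Finset.mem_filter.2 ⟨Finset.mem_univ _, hqp.trans hpi, hqr⟩, hqE⟩)).not_gt hqp

lemma IsGlobalFixedPrioritySchedule.measurableSet_executing
    (hS : IsGlobalFixedPrioritySchedule M prio J S) (i : Fin n) :
    MeasurableSet (executing S i) :=
  MeasurableSet.iUnion fun j => hS.measurableSet i j

-- Markov's inequality for the number of more important tasks executing, with threshold `M`.
open Classical in
lemma IsGlobalFixedPrioritySchedule.mul_busy_le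
    (hS : IsGlobalFixedPrioritySchedule M prio J S) (k : Fin n) (a t : ℝ) :
    M * volume.real (busy S M prio k ∩ Ico a t) ≤
      ∑ i with prio i < prio k, volume.real (executing S i ∩ Ico a t) := by
  set s := Finset.univ.filter fun i => prio i < prio k with hs
  set f : ℝ → ENNReal := fun y => ∑ i ∈ s, (executing S i).indicator 1 y with hf
  have hmeas : ∀ i ∈ s, Measurable ((executing S i).indicator (1 : ℝ → ENNReal)) := fun i _ =>
    measurable_one.indicator (hS.measurableSet_executing i)
  have hfm : Measurable f := Finset.measurable_fun_sum s hmeas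
  have hset : {y | (M : ENNReal) ≤ f y} = busy S M prio k := by
    ext y
    have : f y = ((Finset.univ.filter fun i => prio i < prio k ∧ y ∈ executing S i).card :
        ENNReal) := by
      simp only [hf, hs, Set.indicator_apply, Pi.one_apply, Finset.sum_boole,
        Finset.filter_filter]
    simp only [busy, mem_ofPred_eq, this, Nat.cast_le]
  have h := mul_meas_ge_le_lintegral hfm (μ := volume.restrict (Ico a t)) (M : ENNReal)
  rw [hset, Measure.restrict_apply' measurableSet_Ico, lintegral_finsetSum _ hmeas] at h
  have hint : ∀ i ∈ s, ∫⁻ y in Ico a t, (executing S i).indicator 1 y =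
      volume (executing S i ∩ Ico a t) := fun i _ => by
    rw [lintegral_indicator_one (hS.measurableSet_executing i),
      Measure.restrict_apply' measurableSet_Ico]
  rw [Finset.sum_congr rfl hint] at h
  have h2 := ENNReal.toReal_mono
    (ENNReal.sum_ne_top.2 fun i _ => volume_inter_Ico_ne_top _ _ _) h
  rwa [ENNReal.toReal_mul, ENNReal.toReal_natCast,
    ENNReal.toReal_sum fun i _ => volume_inter_Ico_ne_top _ _ _] at h2

/-- A ready job of task `i` is executed whenever some processor is idle or executes a task that is
not more important than task `k`. -/
lemma IsGlobalFixedPrioritySchedule.idle_le_service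
    (hS : IsGlobalFixedPrioritySchedule M prio J S) {i k : Fin n} (hik : prio i ≤ prio k) {j : ℕ}
    (hj : (j : ℕ∞) < J.count i)
    (hprev : ∀ j' < j, FinishedBy J S i j' (J.release i j)) {t : ℝ}
    (hunf : ¬ FinishedBy J S i j t) :
    volume.real ((busy S M prio k)ᶜ ∩ Ico (J.release i j) t) ≤ service J S i j t := by
  refine volumeReal_inter_Ico_mono fun y hy => ⟨?_, hy.2⟩
  by_contra hyS
  exact hy.1 (hS.mem_busy hik ⟨hj, hy.2.1, fun hf => hunf (hf.mono hy.2.2.le),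
    fun j' hj' => (hprev j' hj').mono hy.2.1⟩ hyS)

/-- If a job of task `k` misses its deadline `d` although all earlier deadlines of relevance are
met, the window ending at `d` extends back to a release time `a` such that all jobs released before
`a` and pending at `a` have been served at rate `u`, while the processors are not all busy with
more important tasks during less than a fraction `u` of the window. -/
lemma IsGlobalFixedPrioritySchedule.exists_window
    (hS : IsGlobalFixedPrioritySchedule M prio J S) {k : Fin n} {l : ℕ} {u : ℝ}
    (hmeet : ∀ i, prio i < prio k → ∀ j : ℕ, (j : ℕ∞) < J.count i →
      FinishedBy J S i j (J.release i j + (τ i).T))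
    (hl : (l : ℕ∞) < J.count k)
    (hprev : ∀ j < l, FinishedBy J S k j (J.release k l))
    (hu : (τ k).utilization ≤ u)
    (hmiss : ¬ FinishedBy J S k l (J.release k l + (τ k).T)) :
    ∃ a ≤ J.release k l,
      (∀ t, a ≤ t → t ≤ J.release k l + (τ k).T →
        volume.real ((busy S M prio k)ᶜ ∩ Ico a t) ≤ u * (J.release k l + (τ k).T - a)) ∧
      volume.real ((busy S M prio k)ᶜ ∩ Ico a (J.release k l + (τ k).T)) <
        u * (J.release k l + (τ k).T - a) ∧
      ∀ i, prio i < prio k → ∀ j : ℕ, (j : ℕ∞) < J.count i → J.release i j < a →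
        ¬ FinishedBy J S i j a → u * (a - J.release i j) ≤ service J S i j a := by
  set r := J.release k l with hr
  set d := r + (τ k).T with hd
  set I := (busy S M prio k)ᶜ with hI
  have hT := (τ k).T_pos
  let A : Set ℝ := {a | a ≤ r ∧ (∃ i, ∃ j : ℕ, (j : ℕ∞) < J.count i ∧ J.release i j = a) ∧
    (∀ t, a ≤ t → t ≤ d → volume.real (I ∩ Ico a t) ≤ u * (d - a)) ∧
    volume.real (I ∩ Ico a d) < u * (d - a)}
  have hfin : A.Finite := by
    refine (Set.finite_iUnion fun i => (J.finite_release_le i r).image (J.release i)).subset ?_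
    rintro a ⟨har, ⟨i, j, hj, rfl⟩, -⟩
    exact mem_iUnion.2 ⟨i, j, ⟨hj, har⟩, rfl⟩
  -- The late job executes at every non-busy instant, yet receives less than C_k ≤ u T_k.
  have hrA : r ∈ A := by
    have hlt : volume.real (I ∩ Ico r d) < u * (d - r) := by
      have h1 := hS.idle_le_service le_rfl hl hprev hmiss
      have h2 : service J S k l d < J.exec k l := not_le.1 hmiss
      have h3 := J.exec_le k l hl
      have h4 := utilization_mul_T (τ k)
      have h5 := mul_le_mul_of_nonneg_right hu hT.le
      rw [hd, add_sub_cancel_left]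
      linarith
    refine ⟨le_rfl, ⟨k, l, hl, rfl⟩, fun t _ htd => le_trans ?_ hlt.le, hlt⟩
    exact volumeReal_inter_Ico_mono (inter_subset_inter_right _ (Ico_subset_Ico_right htd))
  obtain ⟨a, haA, hmin⟩ := Set.exists_min_image A id hfin ⟨r, hrA⟩
  obtain ⟨har, hrel, hle, hlt⟩ := haA
  refine ⟨a, har, hle, hlt, fun i hi j hj hja hunf => ?_⟩
  -- A pending job served at a rate below u executes at all non-busy instants since its release, so
  -- that release would be an earlier candidate.
  by_contra! hserv
  have hprev' : ∀ j' < j, FinishedBy J S i j' (J.release i j) := fun j' hj' => by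
    have hj'c : (j' : ℕ∞) < J.count i := lt_trans (by exact_mod_cast hj') hj
    refine (hmeet i hi j' hj'c).mono (le_trans ?_ (J.release_add_le i (Nat.succ_le_of_lt hj') hj |>
      le_trans (le_add_of_nonneg_right (mul_nonneg ?_ (τ i).T_pos.le))))
    · exact J.separation i j' (lt_of_le_of_lt (by exact_mod_cast hj') hj)
    · rw [sub_nonneg]; exact_mod_cast hj'
  have hidle := (hS.idle_le_service hi.le hj hprev' hunf).trans_lt hserv
  have hext : ∀ t, a ≤ t → volume.real (I ∩ Ico (J.release i j) t) <
      u * (a - J.release i j) + volume.real (I ∩ Ico a t) := fun t ht => by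
    rw [volumeReal_inter_Ico_add I hja.le ht]
    exact add_lt_add_left hidle _
  have had : a ≤ d := har.trans (by linarith)
  have hu0 : 0 ≤ u := (utilization_pos (τ k)).le.trans hu
  refine (hmin (J.release i j) ⟨hja.le.trans har, ⟨i, j, hj, rfl⟩, fun t _ htd => ?_, ?_⟩).not_gt
    hja
  · rcases le_total a t with hat | hat
    · linarith [hext t hat, hle t hat htd]
    · have h1 : volume.real (I ∩ Ico (J.release i j) t) ≤
          volume.real (I ∩ Ico (J.release i j) a) :=
        volumeReal_inter_Ico_mono (inter_subset_inter_right _ (Ico_subset_Ico_right hat))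
      nlinarith [mul_nonneg hu0 (sub_nonneg.2 had)]
  · linarith [hext d had]

lemma IsGlobalFixedPrioritySchedule.finishedBy_deadline
    (hS : IsGlobalFixedPrioritySchedule M prio J S) (hM : 1 ≤ M) {k : Fin n} {l : ℕ} {u : ℝ}
    (hu2 : u ^ 2 - 6 * u + 2 = 0) (hu1 : u < 1)
    (hsum : (∑ i, (τ i).utilization) / M ≤ u) (hmax : ∀ i, (τ i).utilization ≤ u)
    (hTk : ∀ i, prio i < prio k → (τ i).T ≤ (τ k).T)
    (hmeet : ∀ i, prio i < prio k → ∀ j : ℕ, (j : ℕ∞) < J.count i →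
      FinishedBy J S i j (J.release i j + (τ i).T))
    (hl : (l : ℕ∞) < J.count k)
    (hprev : ∀ j < l, FinishedBy J S k j (J.release k l)) :
    FinishedBy J S k l (J.release k l + (τ k).T) := by
  classical
  by_contra hmiss
  obtain ⟨a, har, hle, hlt, hcarry⟩ := hS.exists_window hmeet hl hprev (hmax k) hmiss
  set d := J.release k l + (τ k).T with hd
  have hM0 : (0 : ℝ) < M := by exact_mod_cast hM
  have hTpos := (τ k).T_pos
  have hA : 0 < d - a := by linarith
  set s := Finset.univ.filter fun i => prio i < prio k with hs
  have hmem : ∀ {i}, i ∈ s ↔ prio i < prio k := by simp [hs]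
  have hwork : ∀ i, ∃ w, prio i < prio k → 0 ≤ w ∧ w ≤ (τ i).T ∧
      ∀ (m : ℕ) (t : ℝ), t ≤ a + w + m * (τ i).T →
        volume.real (executing S i ∩ Ico a t) ≤ (τ i).utilization * (w + m * (τ i).T) := by
    intro i
    by_cases hi : prio i < prio k
    · obtain ⟨w, hw⟩ := hS.exists_workload_le i (hmeet i hi) a fun j hj hja hunf =>
        (mul_le_mul_of_nonneg_right (hmax i) (sub_nonneg.2 hja.le)).trans
          (hcarry i hi j hj hja hunf)
      exact ⟨w, fun _ => hw⟩
    · exact ⟨0, fun h => absurd h hi⟩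
  choose w hw using hwork
  -- The number of whole periods between `a + w i` and `d`. The quotient is nonnegative for relevant
  -- tasks, as w_i ≤ T_i ≤ T_k ≤ d - a, so the natural floor loses nothing.
  set m : Fin n → ℕ := fun i => ⌊(d - a - w i) / (τ i).T⌋₊ with hm
  set o : Fin n → ℝ := fun i => w i + m i * (τ i).T with ho
  set v : Fin n → ℝ := fun i => (τ i).utilization / M with hv
  have ho_le : ∀ i ∈ s, o i ≤ d - a := fun i hi => by
    have hi := hmem.1 hi
    have h1 : 0 ≤ (d - a - w i) / (τ i).T :=
      div_nonneg (by linarith [(hw i hi).2.1, hTk i hi]) (τ i).T_pos.le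
    have := (le_div_iff₀ (τ i).T_pos).1 (Nat.floor_le h1)
    simp only [ho, hm]
    linarith
  have hlt_o : ∀ i, d - a < o i + (τ i).T := fun i => by
    have := (div_lt_iff₀ (τ i).T_pos).1 (Nat.lt_floor_add_one ((d - a - w i) / (τ i).T))
    simp only [ho, hm]
    linarith
  have hwork1 : ∀ i ∈ s, ∀ t ≤ a + o i,
      volume.real (executing S i ∩ Ico a t) / M ≤ v i * o i := fun i hi t ht => by
    have := (hw i (hmem.1 hi)).2.2 (m i) t (by simp only [ho] at ht; linarith)
    rw [hv, div_mul_eq_mul_div]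
    exact div_le_div_of_nonneg_right this hM0.le
  have hv0 : ∀ i, 0 ≤ v i := fun i => div_nonneg (utilization_pos _).le hM0.le
  have hwork2 : ∀ i ∈ s, ∀ t ≤ d,
      volume.real (executing S i ∩ Ico a t) / M ≤ v i * o i + (d - a) * v i :=
    fun i hi t ht => by
    have h1 := (hw i (hmem.1 hi)).2.2 (m i + 1) t (by
      have := hlt_o i
      simp only [ho] at this
      push_cast
      linarith)
    -- Rate-monotonicity enters here: the job after the last offset costs U_i T_i ≤ U_i (d - a).
    have h2 : (τ i).T ≤ d - a := by linarith [hTk i (hmem.1 hi)]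
    refine (div_le_div_of_nonneg_right h1 hM0.le).trans ?_
    rw [← div_mul_eq_mul_div]
    have h3 := mul_le_mul_of_nonneg_left h2 (hv0 i)
    simp only [ho, hv] at h3 ⊢
    push_cast
    linarith
  have hbusy : ∀ t, a ≤ t → t - a ≤ volume.real ((busy S M prio k)ᶜ ∩ Ico a t) +
      ∑ i ∈ s, volume.real (executing S i ∩ Ico a t) / M := fun t ht => by
    have h1 : t - a ≤ volume.real ((busy S M prio k)ᶜ ∩ Ico a t) +
        volume.real (busy S M prio k ∩ Ico a t) := by
      rw [← Real.volume_real_Ico_of_le ht]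
      refine le_trans (measureReal_mono (fun y hy => ?_) (measure_union_ne_top
        (volume_inter_Ico_ne_top _ _ _) (volume_inter_Ico_ne_top _ _ _)))
        (measureReal_union_le _ _)
      by_cases hb : y ∈ busy S M prio k
      · exact Or.inr ⟨hb, hy⟩
      · exact Or.inl ⟨hb, hy⟩
    have h2 := hS.mul_busy_le k a t
    rw [← Finset.sum_div]
    have h3 := (le_div_iff₀' hM0).2 h2
    linarith
  refine (window_length_le s v o (u := u) (fun i _ => hv0 i) hA hu2 hu1 ?_ fun j hj => ?_).not_gt ?_
  · refine le_trans ?_ hsum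
    rw [Finset.sum_div]
    exact Finset.sum_le_sum_of_subset_of_nonneg (Finset.filter_subset _ _) fun i _ _ => hv0 i
  · have hoj : 0 ≤ o j := add_nonneg (hw j (hmem.1 hj)).1
      (mul_nonneg (Nat.cast_nonneg _) (τ j).T_pos.le)
    have hojd : a + o j ≤ d := by linarith [ho_le j hj]
    have h1 := hbusy (a + o j) (by linarith)
    have h2 := hle (a + o j) (by linarith) hojd
    have h3 : ∑ i ∈ s, volume.real (executing S i ∩ Ico a (a + o j)) / M ≤
        ∑ i ∈ s, v i * o i + (d - a) * ∑ i ∈ s, if o i < o j then v i else 0 := by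
      rw [Finset.mul_sum, ← Finset.sum_add_distrib]
      refine Finset.sum_le_sum fun i hi => ?_
      -- Only tasks whose last offset lies strictly before `o j` can have started that extra job.
      split_ifs with hij
      · exact hwork2 i hi _ hojd
      · simpa using hwork1 i hi (a + o j) (by linarith)
    linarith
  · have h1 := hbusy d (by linarith)
    have h3 : ∑ i ∈ s, volume.real (executing S i ∩ Ico a d) / M ≤
        ∑ i ∈ s, v i * o i + (d - a) * ∑ i ∈ s, v i := by
      rw [Finset.mul_sum, ← Finset.sum_add_distrib]
      exact Finset.sum_le_sum fun i hi => hwork2 i hi d le_rfl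
    linarith

lemma schedulable_of_utilization_le {τ : Fin n → SporadicTask} (hM : 1 ≤ M) {u : ℝ}
    (himp : ImplicitDeadline τ) (hu2 : u ^ 2 - 6 * u + 2 = 0) (hu1 : u < 1)
    (hsum : (∑ i, (τ i).utilization) / M ≤ u) (hmax : ∀ i, (τ i).utilization ≤ u)
    (hprio : IsRateMonotonic τ prio) : Schedulable τ M prio := by
  -- Induction on priority values, then on the jobs of the task: more important tasks and earlier
  -- jobs meet their deadlines.
  suffices h : ∀ p k, prio k = p → TaskSchedulable τ M prio k from fun k => h _ k rfl
  intro p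
  induction p using Nat.strong_induction_on with
  | _ p ih =>
    rintro k rfl J S hS l
    induction l using Nat.strong_induction_on with
    | _ l ihl =>
      intro hl
      rw [himp k]
      refine hS.finishedBy_deadline hM hu2 hu1 hsum hmax
        (fun i hi => not_lt.1 fun h => (hprio.2 k i h).asymm hi)
        (fun i hi j hj => himp i ▸ ih _ hi i rfl J S hS j hj) hl fun j hj => ?_
      have h1 := ihl j hj (lt_trans (by exact_mod_cast hj) hl)
      rw [himp k] at h1
      refine h1.mono (le_trans ?_ (J.release_add_le k hj.le hl))
      have : (1 : ℝ) ≤ (l : ℝ) - j := by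
        have : ((j + 1 : ℕ) : ℝ) ≤ l := by exact_mod_cast hj
        push_cast at this; linarith
      nlinarith [(τ k).T_pos]

end RealTime

theorem corollary3 :
    RealTime.IsGlobalRMCapacityAugmentationFactor ((3 + Real.sqrt 7) / 2) ∧
      |(3 + Real.sqrt 7) / 2 - 2.823| < 0.0005 := by
  have hsq : Real.sqrt 7 ^ 2 = 7 := Real.sq_sqrt (by norm_num)
  have hlo : 2.645 < Real.sqrt 7 := Real.lt_sqrt_of_sq_lt (by norm_num)
  have hhi : Real.sqrt 7 < 2.6468 := (Real.sqrt_lt' (by norm_num)).2 (by norm_num)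
  refine ⟨⟨by positivity, fun M hM n τ himp hsum hmax prio hprio => ?_⟩, ?_⟩
  · have hinv : 1 / ((3 + Real.sqrt 7) / 2) = 3 - Real.sqrt 7 := by
      rw [div_eq_iff (by positivity)]
      nlinarith
    rw [hinv] at hsum
    simp only [hinv] at hmax
    exact RealTime.schedulable_of_utilization_le hM himp (by nlinarith) (by linarith) hsum hmax
      hprio
  · rw [abs_lt]
    constructor <;> linarith
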